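/- Let $K$ be a positive integer and consider a memoryless 1-to-$K$ broadcast packet erasure channel with channel output feedback. It is given by nonnegative numbers $p_{S\overline{[K]\setminus S}}$, $S\subseteq[K]=\{1,\dots,K\}$, with sum $1$: whenever a symbol $y$ of a finite field $\mathrm{GF}(q)$ is sent, then, independently in each time slot, it is received by exactly the receivers in $S$ with probability $p_{S\overline{[K]\setminus S}}$, while the other receivers see an erasure $*$. For $S\subseteq [K]$ let $$p_{\cup S}=\sum_{S'\subseteq[K]:\,S'\cap S\neq\emptyset}p_{S'\overline{[K]\setminus S'}}.$$ A feedback code of length $n$ with $m_k$ information symbols for receiver $k$ consists of encoding functions $f_t$ and decoding functions $g_k$. The information symbols $\mathbf X_k\in \mathrm{GF}(q)^{m_k}$, $k\in[K]$, are independent and uniform; the symbol sent in slot $t$ is $Y(t)=f_t(\mathbf X_1,\dots,\mathbf X_K,\mathbf Z(1),\dots,\mathbf Z(t-1))$, where $\mathbf Z(\tau)=(Z_1(\tau),\dots,Z_K(\tau))$ is the vector of the outputs at all receivers in slot $\tau$; receiver $k$ outputs $\hat{\mathbf X}_k=g_k(Z_k(1),\dots,Z_k(n))$. A vector $(R_1,\dots,R_K)$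 of nonnegative reals is achievable if for every $\epsilon>0$ there are arbitrarily large $n$ for which there exist a finite field $\mathrm{GF}(q)$ (as large as desired) and a feedback code of length $n$ with $m_k=\lfloor nR_k\rfloor$ and $\mathsf{Prob}(\hat{\mathbf X}_k\ne\mathbf X_k)<\epsilon$ for all $k\in[K]$. Proposition. Every achievable rate vector $(R_1,\dots,R_K)$ satisfies, for each of the $K!$ permutations $\pi$ of $[K]$, $$\sum_{j=1}^K\frac{R_{\pi(j)}}{p_{\cup S^\pi_j}}\le 1,\qquad S^\pi_j=\{\pi(1),\dots,\pi(j)\},$$ where, if $p_{\cup S^\pi_j}=0$ for some $j$, the inequality is understood to say that $R_{\pi(j)}=0$ and that the corresponding term is $0$. -/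

import Mathlib

/-- A memoryless 1-to-`K` broadcast packet erasure channel. Receivers are indexed by `Fin K`;
`prob S` is the probability that a transmitted symbol is received by and only by the receivers
in `S`. Arbitrary spatial dependence between the receivers is allowed. -/
structure BroadcastPEC (K : ℕ) where
  prob : Finset (Fin K) → ℝ
  prob_nonneg : ∀ S, 0 ≤ prob S
  sum_prob : ∑ S, prob S = 1

/-- The channel output vector when `y` is sent and is received exactly by the receivers in `S`;
the erasure symbol `*` is `none`. -/
def BroadcastPEC.received {K : ℕ} {F : Type} (y : F) (S : Finset (Fin K)) : Fin K → Option F :=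
  fun k => if k ∈ S then some y else none

namespace BroadcastPEC

variable {K : ℕ}

/-- The probability that at least one receiver in `S` receives the transmitted symbol. -/
def pUnion (C : BroadcastPEC K) (S : Finset (Fin K)) : ℝ :=
  ∑ S' with (S' ∩ S).Nonempty, C.prob S'

open Classical in
/-- The transition probability of one channel use: the probability of the output vector `z`
given that the input symbol is `y`. -/
noncomputable def transition (C : BroadcastPEC K) {F : Type} (y : F) (z : Fin K → Option F) : ℝ :=
  ∑ S with received y S = z, C.prob S

end BroadcastPEC

/-- The tuples of information symbols: session `k` carries `m k` symbols of `F`. -/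
abbrev PECMessages {K : ℕ} (F : Type) (m : Fin K → ℕ) : Type := (k : Fin K) → Fin (m k) → F

/-- A block code of length `n` with channel output feedback: the symbol sent in slot `t` is a
function of all information symbols and of the output vectors of all receivers in the earlier
slots; receiver `k` decodes from its own `n` outputs only. -/
structure PECFeedbackCode (K : ℕ) (F : Type) (n : ℕ) (m : Fin K → ℕ) where
  encode : (t : Fin n) → PECMessages F m → (Fin t → Fin K → Option F) → F
  decode : (k : Fin K) → (Fin n → Option F) → (Fin (m k) → F)

namespace PECFeedbackCode

variable {K : ℕ} {F : Type} [Fintype F] {n : ℕ} {m : Fin K → ℕ}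

/-- The joint probability that the information symbols are `x` and the channel outputs are
`z 0, …, z (n - 1)`: the information symbols are independent and uniform on `F`, and in slot `t`
the channel is used, memorylessly, with the input that the encoder computes from `x` and
`z 0, …, z (t - 1)`. -/
noncomputable def jointProb (c : PECFeedbackCode K F n m) (C : BroadcastPEC K)
    (x : PECMessages F m) (z : Fin n → Fin K → Option F) : ℝ :=
  (Fintype.card (PECMessages F m) : ℝ)⁻¹ *
    ∏ t : Fin n,
      C.transition (c.encode t x (fun τ => z (Fin.castLE t.isLt.le τ))) (z t)

open Classical in
/-- The probability that receiver `k` does not decode its own information symbols correctly. -/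
noncomputable def errorProb (c : PECFeedbackCode K F n m) (C : BroadcastPEC K) (k : Fin K) : ℝ :=
  ∑ x : PECMessages F m, ∑ z : Fin n → Fin K → Option F,
    if c.decode k (fun t => z t k) ≠ x k then c.jointProb C x z else 0

end PECFeedbackCode

/-- The (nonnegative) rate vector `R` is achievable with channel output feedback: for every
`ε > 0` there are arbitrarily large block lengths `n`, a finite field and a feedback code with
`⌊n R_k⌋` information symbols for receiver `k` whose error probabilities are all below `ε`.
The field may be as large as desired; it may depend on `ε` and `n`. -/
def BroadcastPEC.Achievable {K : ℕ} (C : BroadcastPEC K) (R : Fin K → ℝ) : Prop :=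
  (∀ k, 0 ≤ R k) ∧
    ∀ ε : ℝ, 0 < ε → ∀ N : ℕ, ∃ n : ℕ, N ≤ n ∧
      ∃ (F : Type) (_ : Field F) (_ : Fintype F)
        (c : PECFeedbackCode K F n (fun k => ⌊(n : ℝ) * R k⌋₊)),
        ∀ k, c.errorProb C k < ε

/-- The set `{π(1), …, π(j)}` of the first receivers under `π`, up to and including the one in
position `j`. -/
def firstReceivers {K : ℕ} (π : Equiv.Perm (Fin K)) (j : Fin K) : Finset (Fin K) :=
  (Finset.Iic j).image π

/-!
The bound is the converse for a physically degraded broadcast channel with feedback: passing from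
receiver `π j` to the group of the first `j` receivers under `π` can only help, and the groups
increase with `j`.

Once the erasure pattern `s` (the set of receivers reached in each slot) is fixed, the feedback
code is deterministic, so every quantity is a function of the uniform information symbols, whose
entropy is computed from the sizes of its fibres. Let `T` be the first receivers under `π` before
`k = π j`, and `T' = insert k T`. For a fixed pattern, the information that the symbols received by
`T'` give about the message of `k`, given the messages of `T`, is by the chain rule a sum over the
slots that reach `T'` of differences of entropies of the channel input
(`uniformEntropy_view_sub`). By Fano's inequality it is at least the entropy of the message, up to
the loss due to errors (`log_card_mul_le_sum_inputEntropy`). By causality these input entropies do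
not depend on the erasures of their own slot, so averaging over the pattern pulls out the factor
`C.pUnion T'` (`sum_patternProb_mul`). After division by this factor, and since conditioning on
less can only increase the entropy, the right-hand side becomes a difference of consecutive values
of `meanInputEntropy` (`message_entropy_le`). The differences telescope over `j`, and their sum is
at most `n * log |F|` (`exists_budget`). The theorem follows as the block length grows and the
error probability tends to zero.

The entropy inequalities needed are all instances of Gibbs' inequality
(`uniformCondEntropy_le_of_kernel`).
-/

open Finset

/-! ### Entropy of functions of a uniform variable -/

section Entropy

variable {X A B D : Type*} [Fintype X]

open Classical in
/-- The number of points of `X` at which `f` takes the same value as at `x`. -/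
noncomputable def fiberCard (f : X → A) (x : X) : ℕ :=
  #{x' | f x' = f x}

/-- The Shannon entropy, in nats, of `f x` for `x` uniform on `X`: the mean of the information
content `-log (fiberCard f x / |X|)`. It depends only on the partition of `X` into fibres of `f`,
so the codomain need not be finite. -/
noncomputable def uniformEntropy (f : X → A) : ℝ :=
  (∑ x, Real.log (Fintype.card X / fiberCard f x)) / Fintype.card X

/-- The conditional entropy of `f x` given `g x` for `x` uniform on `X`. -/
noncomputable def uniformCondEntropy (f : X → A) (g : X → B) : ℝ :=
  uniformEntropy (fun x => (f x, g x)) - uniformEntropy g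

lemma fiberCard_pos (f : X → A) (x : X) : 0 < fiberCard f x :=
  Finset.card_pos.2 ⟨x, by simp⟩

lemma fiberCard_congr {f : X → A} {g : X → B} (h : ∀ x x', f x' = f x ↔ g x' = g x) (x : X) :
    fiberCard f x = fiberCard g x := by
  classical
  simp only [fiberCard, h]

lemma uniformEntropy_congr {f : X → A} {g : X → B} (h : ∀ x x', f x' = f x ↔ g x' = g x) :
    uniformEntropy f = uniformEntropy g := by
  simp only [uniformEntropy, fiberCard_congr h]

lemma uniformCondEntropy_eq (f : X → A) (g : X → B) :
    uniformCondEntropy f g =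
      (∑ x, Real.log (fiberCard g x / fiberCard (fun x => (f x, g x)) x)) / Fintype.card X := by
  rw [uniformCondEntropy, uniformEntropy, uniformEntropy, ← sub_div, ← Finset.sum_sub_distrib]
  congr 1
  refine Finset.sum_congr rfl fun x _ => ?_
  have h0 : (Fintype.card X : ℝ) ≠ 0 := by
    have : Nonempty X := ⟨x⟩
    exact_mod_cast Fintype.card_ne_zero
  have h1 : (fiberCard g x : ℝ) ≠ 0 := by exact_mod_cast (fiberCard_pos g x).ne'
  have h2 : (fiberCard (fun x => (f x, g x)) x : ℝ) ≠ 0 := by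
    exact_mod_cast (fiberCard_pos _ x).ne'
  rw [Real.log_div h0 h2, Real.log_div h0 h1, Real.log_div h1 h2]
  ring

lemma uniformCondEntropy_nonneg (f : X → A) (g : X → B) : 0 ≤ uniformCondEntropy f g := by
  classical
  rw [uniformCondEntropy_eq]
  refine div_nonneg (Finset.sum_nonneg fun x _ => Real.log_nonneg ?_) (Nat.cast_nonneg _)
  rw [one_le_div (by exact_mod_cast fiberCard_pos _ x)]
  refine Nat.cast_le.2 (Finset.card_le_card fun x' hx' => ?_)
  simp only [mem_filter, mem_univ, true_and, Prod.mk.injEq] at hx' ⊢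
  exact hx'.2

lemma sum_fiberCard_mul_le [Fintype A] (f : X → A) (g : X → B) (Q : A → B → ℝ)
    (hQ : ∀ a b, 0 ≤ Q a b) (hsum : ∀ b, ∑ a, Q a b ≤ 1) :
    ∑ x, (fiberCard g x : ℝ) / fiberCard (fun x => (f x, g x)) x * Q (f x) (g x)
      ≤ Fintype.card X := by
  classical
  -- Expand `fiberCard g x` as a sum over the points `x'` of the fibre, and sum over `x` first.
  calc ∑ x, (fiberCard g x : ℝ) / fiberCard (fun x => (f x, g x)) x * Q (f x) (g x)
      = ∑ x, ∑ x', if g x = g x' then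
          Q (f x) (g x') / fiberCard (fun x => (f x, g x)) x else 0 := by
        refine Finset.sum_congr rfl fun x _ => ?_
        have : ∀ x', (if g x = g x' then
            Q (f x) (g x') / (fiberCard (fun x => (f x, g x)) x : ℝ) else 0) =
            if g x' = g x then
            Q (f x) (g x) / (fiberCard (fun x => (f x, g x)) x : ℝ) else 0 := by
          intro x'
          by_cases h : g x' = g x
          · rw [if_pos h, if_pos h.symm, h]
          · rw [if_neg h, if_neg (fun h' => h h'.symm)]
        simp only [this]
        rw [← Finset.sum_filter, Finset.sum_const, nsmul_eq_mul]
        simp only [fiberCard]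
        ring
    _ = ∑ x', ∑ x, if g x = g x' then
          Q (f x) (g x') / fiberCard (fun x => (f x, g x)) x else 0 := Finset.sum_comm
    _ ≤ ∑ _x' : X, (1 : ℝ) := by
        refine Finset.sum_le_sum fun x' _ => le_trans ?_ (hsum (g x'))
        rw [← Finset.sum_fiberwise (s := univ) (g := f)]
        refine Finset.sum_le_sum fun a _ => ?_
        rw [← Finset.sum_filter, Finset.filter_filter]
        set s : Finset X := {x | f x = a ∧ g x = g x'} with hs
        have : ∀ x ∈ s, Q (f x) (g x') / (fiberCard (fun x => (f x, g x)) x : ℝ) =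
            Q a (g x') / (#s : ℝ) := by
          intro x hx
          have hx := (Finset.mem_filter.1 hx).2
          rw [hx.1]
          congr 2
          simp only [fiberCard, hs, hx.1, hx.2, Prod.mk.injEq]
        rw [Finset.sum_congr rfl this, Finset.sum_const, nsmul_eq_mul]
        rcases Nat.eq_zero_or_pos #s with h0 | h0
        · rw [h0]
          simpa using hQ a (g x')
        · have : (#s : ℝ) ≠ 0 := by exact_mod_cast h0.ne'
          rw [mul_div_cancel₀ _ this]
    _ = Fintype.card X := by simp

/-- Gibbs' inequality: coding `f x` given `g x` with the code lengths of an arbitrary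
(sub-)probability kernel `Q` costs at least the conditional entropy. The comparison with the
uniform kernel, the monotonicity in the conditioning and Fano's inequality are all obtained from it
by a choice of `Q`. -/
lemma uniformCondEntropy_le_of_kernel [Fintype A] (f : X → A) (g : X → B) (Q : A → B → ℝ)
    (hQ : ∀ a b, 0 ≤ Q a b) (hsum : ∀ b, ∑ a, Q a b ≤ 1) (hpos : ∀ x, 0 < Q (f x) (g x)) :
    uniformCondEntropy f g ≤ (∑ x, -Real.log (Q (f x) (g x))) / Fintype.card X := by
  rw [uniformCondEntropy_eq]
  refine div_le_div_of_nonneg_right ?_ (Nat.cast_nonneg _)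
  rw [← sub_nonpos, ← Finset.sum_sub_distrib]
  calc ∑ x, (Real.log (fiberCard g x / fiberCard (fun x => (f x, g x)) x)
        - -Real.log (Q (f x) (g x)))
      ≤ ∑ x, ((fiberCard g x : ℝ) / fiberCard (fun x => (f x, g x)) x * Q (f x) (g x) - 1) := by
        refine Finset.sum_le_sum fun x _ => ?_
        have h1 : (0 : ℝ) < fiberCard g x := by exact_mod_cast fiberCard_pos g x
        have h2 : (0 : ℝ) < fiberCard (fun x => (f x, g x)) x := by
          exact_mod_cast fiberCard_pos _ x
        have h3 := div_pos h1 h2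
        rw [sub_neg_eq_add, ← Real.log_mul h3.ne' (hpos x).ne']
        exact Real.log_le_sub_one_of_pos (mul_pos h3 (hpos x))
    _ ≤ 0 := by
        rw [Finset.sum_sub_distrib]
        have := sum_fiberCard_mul_le f g Q hQ hsum
        simpa using this

lemma uniformCondEntropy_le_log_card [Nonempty X] [Fintype A] (f : X → A) (g : X → B) :
    uniformCondEntropy f g ≤ Real.log (Fintype.card A) := by
  have : Nonempty A := ⟨f (Classical.arbitrary X)⟩
  have hA : (0 : ℝ) < Fintype.card A := by exact_mod_cast Fintype.card_pos
  have hX : (Fintype.card X : ℝ) ≠ 0 := by exact_mod_cast Fintype.card_ne_zero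
  refine (uniformCondEntropy_le_of_kernel f g (fun _ _ => (Fintype.card A : ℝ)⁻¹)
    (fun _ _ => (inv_pos.2 hA).le) (fun _ => ?_) (fun _ => inv_pos.2 hA)).trans (le_of_eq ?_)
  · simp [hA.ne']
  · simp [Real.log_inv, hX]

lemma uniformCondEntropy_prod_le [Fintype A] (f : X → A) (g : X → B) (h : X → D) :
    uniformCondEntropy f (fun x => (g x, h x)) ≤ uniformCondEntropy f g := by
  classical
  -- The kernel is the conditional law of `f` given `g`.
  refine (uniformCondEntropy_le_of_kernel f (fun x => (g x, h x))
    (fun a b => (#{x | f x = a ∧ g x = b.1} : ℝ) / #{x | g x = b.1})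
    (fun _ _ => by positivity) (fun b => ?_) (fun x => ?_)).trans (le_of_eq ?_)
  · rw [← Finset.sum_div]
    refine div_le_one_of_le₀ (le_of_eq ?_) (Nat.cast_nonneg _)
    rw [Finset.card_eq_sum_card_fiberwise (f := f) (t := univ) (by simp)]
    push_cast
    refine Finset.sum_congr rfl fun a _ => ?_
    rw [Finset.filter_filter]
    simp only [and_comm]
  · have h1 : 0 < #{x' | f x' = f x ∧ g x' = g x} := Finset.card_pos.2 ⟨x, by simp⟩
    have h2 : 0 < #{x' | g x' = g x} := Finset.card_pos.2 ⟨x, by simp⟩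
    positivity
  · rw [uniformCondEntropy_eq]
    congr 1
    refine Finset.sum_congr rfl fun x _ => ?_
    rw [← Real.log_inv, inv_div]
    simp only [fiberCard, Prod.mk.injEq]

lemma uniformCondEntropy_congr_right (f : X → A) {g : X → B} {g' : X → D}
    (h : ∀ x x', g x' = g x ↔ g' x' = g' x) :
    uniformCondEntropy f g = uniformCondEntropy f g' := by
  rw [uniformCondEntropy, uniformCondEntropy, uniformEntropy_congr h]
  congr 1
  exact uniformEntropy_congr fun x x' => by simp only [Prod.mk.injEq, h]

/-- Conditioning on a finer function reduces the conditional entropy. -/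
lemma uniformCondEntropy_anti [Fintype A] (f : X → A) {g : X → B} {g' : X → D}
    (h : ∀ x x', g' x' = g' x → g x' = g x) :
    uniformCondEntropy f g' ≤ uniformCondEntropy f g := by
  refine le_trans (le_of_eq ?_) (uniformCondEntropy_prod_le f g g')
  refine uniformCondEntropy_congr_right f fun x x' => ?_
  simp only [Prod.mk.injEq]
  exact ⟨fun h' => ⟨h x x' h', h'⟩, fun h' => h'.2⟩

open Classical in
/-- Fano's inequality. -/
lemma uniformCondEntropy_le_fano [Nonempty X] [Fintype A] (f : X → A) (g : X → B) (d : B → A) :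
    uniformCondEntropy f g ≤ Real.log 2 +
      (#{x | d (g x) ≠ f x} : ℝ) / Fintype.card X * Real.log (Fintype.card A) := by
  have : Nonempty A := ⟨f (Classical.arbitrary X)⟩
  have hA : (0 : ℝ) < Fintype.card A := by exact_mod_cast Fintype.card_pos
  have hX : (0 : ℝ) < Fintype.card X := by exact_mod_cast Fintype.card_pos
  -- The kernel puts half of the mass on the decoder's guess and spreads the other half evenly.
  refine (uniformCondEntropy_le_of_kernel f g
    (fun a b => (if d b = a then 1 / 2 else 0) + (2 * (Fintype.card A : ℝ))⁻¹)
    (fun _ _ => by positivity) (fun b => ?_) (fun x => by positivity)).trans ?_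
  · rw [Finset.sum_add_distrib]
    simp only [sum_ite_eq, mem_univ, if_true, sum_const, card_univ, nsmul_eq_mul]
    apply le_of_eq
    field_simp
    norm_num
  · have hle : ∀ x, -Real.log ((if d (g x) = f x then 1 / 2 else 0)
        + (2 * (Fintype.card A : ℝ))⁻¹) ≤
        Real.log 2 + if d (g x) ≠ f x then Real.log (Fintype.card A) else 0 := by
      intro x
      by_cases h : d (g x) = f x
      · simp only [h, if_true, ne_eq, not_true_eq_false, if_false, add_zero]
        rw [← Real.log_inv]
        refine Real.log_le_log (by positivity) ?_
        rw [inv_le_comm₀ (by positivity) (by norm_num)]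
        have : (0 : ℝ) < (2 * (Fintype.card A : ℝ))⁻¹ := by positivity
        linarith
      · simp only [h, if_false, ne_eq, not_false_eq_true, if_true, zero_add]
        rw [Real.log_inv, neg_neg, Real.log_mul (by norm_num) hA.ne']
    rw [div_le_iff₀ hX]
    refine (Finset.sum_le_sum fun x _ => hle x).trans (le_of_eq ?_)
    rw [Finset.sum_add_distrib, ← Finset.sum_filter]
    simp only [sum_const, card_univ, nsmul_eq_mul]
    field_simp

end Entropy

/-! ### Erasure patterns and runs of a feedback code -/

namespace BroadcastPEC

variable {K n : ℕ}

/-- The probability of the erasure pattern `s`, where `s t` is the set of receivers that receive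
the symbol sent in slot `t`. -/
noncomputable def patternProb (C : BroadcastPEC K) (s : Fin n → Finset (Fin K)) : ℝ :=
  ∏ t, C.prob (s t)

lemma patternProb_nonneg (C : BroadcastPEC K) (s : Fin n → Finset (Fin K)) :
    0 ≤ C.patternProb s :=
  Finset.prod_nonneg fun _ _ => C.prob_nonneg _

lemma sum_patternProb (C : BroadcastPEC K) :
    ∑ s : Fin n → Finset (Fin K), C.patternProb s = 1 := by
  have h := Finset.prod_univ_sum (fun _ : Fin n => (univ : Finset (Finset (Fin K))))
    (fun _ S => C.prob S)
  rw [Fintype.piFinset_univ] at h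
  simp only [patternProb]
  rw [← h]
  simp [C.sum_prob]

lemma prob_mul_patternProb_update (C : BroadcastPEC K) (s : Fin n → Finset (Fin K)) (t : Fin n)
    (S : Finset (Fin K)) :
    C.prob (s t) * C.patternProb (Function.update s t S) = C.prob S * C.patternProb s := by
  classical
  have h1 := Finset.mul_prod_erase univ (fun τ => C.prob (Function.update s t S τ)) (mem_univ t)
  have h2 := Finset.mul_prod_erase univ (fun τ => C.prob (s τ)) (mem_univ t)
  have h3 : ∏ τ ∈ univ.erase t, C.prob (Function.update s t S τ) =
      ∏ τ ∈ univ.erase t, C.prob (s τ) :=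
    Finset.prod_congr rfl fun τ hτ => by
      rw [Function.update_of_ne (Finset.ne_of_mem_erase hτ)]
  simp only [Function.update_self] at h1
  rw [patternProb, patternProb, ← h1, ← h2, h3]
  ring

/-- The erasures in slot `t` are independent of every function of the pattern that does not
depend on slot `t`. -/
lemma sum_patternProb_mul (C : BroadcastPEC K) (t : Fin n) (φ : Finset (Fin K) → ℝ)
    (f : (Fin n → Finset (Fin K)) → ℝ) (hf : ∀ s S, f (Function.update s t S) = f s) :
    ∑ s, C.patternProb s * (φ (s t) * f s) =
      (∑ S, C.prob S * φ S) * ∑ s, C.patternProb s * f s := by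
  classical
  -- Draw an independent copy `S` of the slot, and exchange it with `s t`.
  have hinv : Function.Involutive
      (fun p : Finset (Fin K) × (Fin n → Finset (Fin K)) => (p.2 t, Function.update p.2 t p.1)) := by
    rintro ⟨S, s⟩
    simp
  calc ∑ s, C.patternProb s * (φ (s t) * f s)
      = ∑ S, ∑ s, C.prob S * (C.patternProb s * (φ (s t) * f s)) := by
        simp only [← Finset.mul_sum]
        rw [← Finset.sum_mul, C.sum_prob, one_mul]
    _ = ∑ p : Finset (Fin K) × (Fin n → Finset (Fin K)),
          C.prob p.1 * (C.patternProb p.2 * (φ (p.2 t) * f p.2)) := by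
        rw [Fintype.sum_prod_type]
    _ = ∑ p : Finset (Fin K) × (Fin n → Finset (Fin K)),
          (C.prob p.1 * φ p.1) * (C.patternProb p.2 * f p.2) := by
        rw [← Equiv.sum_comp hinv.toPerm]
        refine Finset.sum_congr rfl fun p _ => ?_
        have := C.prob_mul_patternProb_update p.2 t p.1
        simp only [Function.Involutive.coe_toPerm, Function.update_self, hf]
        linear_combination (φ p.1 * f p.2) * this
    _ = _ := by
        rw [Fintype.sum_prod_type, Finset.sum_mul_sum]

lemma pUnion_nonneg (C : BroadcastPEC K) (S : Finset (Fin K)) : 0 ≤ C.pUnion S :=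
  Finset.sum_nonneg fun _ _ => C.prob_nonneg _

end BroadcastPEC

namespace PECFeedbackCode

open BroadcastPEC

variable {K : ℕ} {F : Type} {n : ℕ} {m : Fin K → ℕ}

/-- The channel outputs when the information symbols are `x` and the erasure pattern is `s`. -/
def outputs (c : PECFeedbackCode K F n m) (x : PECMessages F m) (s : Fin n → Finset (Fin K))
    (t : Fin n) : Fin K → Option F :=
  received (c.encode t x fun τ : Fin t => outputs c x s (Fin.castLE t.isLt.le τ)) (s t)
termination_by t.val
decreasing_by exact τ.isLt

/-- The symbol sent in slot `t` when the information symbols are `x` and the erasure pattern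
is `s`. -/
def input (c : PECFeedbackCode K F n m) (x : PECMessages F m) (s : Fin n → Finset (Fin K))
    (t : Fin n) : F :=
  c.encode t x fun τ => c.outputs x s (Fin.castLE t.isLt.le τ)

lemma outputs_eq (c : PECFeedbackCode K F n m) (x : PECMessages F m)
    (s : Fin n → Finset (Fin K)) (t : Fin n) :
    c.outputs x s t = received (c.input x s t) (s t) := by
  rw [outputs, input]

lemma outputs_congr (c : PECFeedbackCode K F n m) (x : PECMessages F m)
    {s s' : Fin n → Finset (Fin K)} (i : ℕ) (h : ∀ τ : Fin n, τ.val < i → s τ = s' τ) :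
    ∀ t : Fin n, t.val < i → c.outputs x s t = c.outputs x s' t := by
  induction i with
  | zero => intro t ht; omega
  | succ i ih =>
    intro t ht
    have ih := ih fun τ hτ => h τ (by omega)
    rw [outputs, outputs, h t ht]
    congr 2
    funext τ
    exact ih _ (by have := τ.isLt; simp only [Fin.val_castLE]; omega)

/-- By causality the channel input of a slot depends only on the erasures in the earlier slots. -/
lemma input_congr (c : PECFeedbackCode K F n m) (x : PECMessages F m)
    {s s' : Fin n → Finset (Fin K)} (t : Fin n) (h : ∀ τ < t, s τ = s' τ) :
    c.input x s t = c.input x s' t := by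
  rw [input, input]
  congr 1
  funext τ
  exact c.outputs_congr x t h _ τ.isLt

/-! ### Views of groups of receivers -/

/-- The information symbols of the receivers in `T`; the others are masked. -/
def messagePart (T : Finset (Fin K)) (x : PECMessages F m) (k : Fin K) :
    Option (Fin (m k) → F) :=
  if k ∈ T then some (x k) else none

/-- The symbols that reach at least one receiver in `T` before slot `i`. -/
def view (c : PECFeedbackCode K F n m) (s : Fin n → Finset (Fin K)) (T : Finset (Fin K)) (i : ℕ)
    (x : PECMessages F m) (τ : Fin n) : Option F :=
  if τ.val < i ∧ (s τ ∩ T).Nonempty then some (c.input x s τ) else none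

lemma messagePart_eq_iff {T : Finset (Fin K)} {x x' : PECMessages F m} :
    messagePart T x' = messagePart T x ↔ ∀ k ∈ T, x' k = x k := by
  simp only [funext_iff, messagePart]
  refine forall_congr' fun k => ?_
  by_cases h : k ∈ T
  · simp only [h, if_true, Option.some.injEq, forall_const, funext_iff]
  · simp [h]

lemma view_eq_iff {c : PECFeedbackCode K F n m} {s : Fin n → Finset (Fin K)}
    {T : Finset (Fin K)} {i : ℕ} {x x' : PECMessages F m} :
    c.view s T i x' = c.view s T i x ↔
      ∀ τ : Fin n, τ.val < i → (s τ ∩ T).Nonempty → c.input x' s τ = c.input x s τ := by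
  simp only [funext_iff, view]
  refine forall_congr' fun τ => ?_
  by_cases h : τ.val < i ∧ (s τ ∩ T).Nonempty
  · simp only [h, and_self, if_true, Option.some.injEq, forall_const]
  · simp only [if_neg h, true_iff]
    exact fun h1 h2 => absurd ⟨h1, h2⟩ h

variable [Fintype F]

open Classical in
/-- The probability, over uniform information symbols, that receiver `k` decodes wrongly when the
erasure pattern is `s`. -/
noncomputable def patternError (c : PECFeedbackCode K F n m) (s : Fin n → Finset (Fin K))
    (k : Fin K) : ℝ :=
  (#{x | c.decode k (fun t => c.outputs x s t k) ≠ x k} : ℝ) / Fintype.card (PECMessages F m)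

/-- The law of the outputs given the information symbols is a mixture over erasure patterns, each
of which makes the outputs deterministic. -/
lemma sum_patternProb_mul_patternError_le (c : PECFeedbackCode K F n m) (C : BroadcastPEC K)
    (k : Fin K) : ∑ s, C.patternProb s * c.patternError s k ≤ c.errorProb C k := by
  classical
  set a : ℝ := (Fintype.card (PECMessages F m) : ℝ)⁻¹ with ha
  have ha0 : 0 ≤ a := by positivity
  have hlhs : ∑ s, C.patternProb s * c.patternError s k =
      ∑ x, ∑ s, if c.decode k (fun t => c.outputs x s t k) ≠ x k then
        a * C.patternProb s else 0 := by
    rw [Finset.sum_comm]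
    refine Finset.sum_congr rfl fun s _ => ?_
    rw [← Finset.sum_filter, Finset.sum_const, nsmul_eq_mul, patternError, ha]
    ring
  rw [hlhs, errorProb]
  refine Finset.sum_le_sum fun x _ => ?_
  have hjoint : ∀ z, c.jointProb C x z = ∑ s : Fin n → Finset (Fin K),
      if ∀ t, received (c.encode t x fun τ => z (Fin.castLE t.isLt.le τ)) (s t) = z t then
        a * C.patternProb s else 0 := by
    intro z
    simp only [jointProb, transition]
    rw [Finset.prod_univ_sum, Finset.mul_sum, ← Finset.sum_filter]
    refine Finset.sum_congr ?_ fun s _ => rfl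
    ext s
    simp only [Fintype.mem_piFinset, mem_filter, mem_univ, true_and]
  calc _ ≤ ∑ s, ∑ z : Fin n → Fin K → Option F,
        if c.decode k (fun t => z t k) ≠ x k then
          (if ∀ t, received (c.encode t x fun τ => z (Fin.castLE t.isLt.le τ)) (s t) = z t then
            a * C.patternProb s else 0) else 0 := by
        refine Finset.sum_le_sum fun s _ => ?_
        refine le_trans (le_of_eq ?_) (Finset.single_le_sum (fun z _ => ?_)
          (mem_univ (c.outputs x s)))
        · have : ∀ t, received (c.encode t x fun τ => c.outputs x s (Fin.castLE t.isLt.le τ)) (s t)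
              = c.outputs x s t := fun t => by rw [outputs_eq, input]
          rw [if_pos this]
        · have := mul_nonneg ha0 (C.patternProb_nonneg s)
          split_ifs <;> simp [this]
    _ = _ := by
        rw [Finset.sum_comm]
        refine Finset.sum_congr rfl fun z _ => ?_
        by_cases h : c.decode k (fun t => z t k) ≠ x k
        · simp only [if_pos h, hjoint]
        · simp only [if_neg h, Finset.sum_const_zero]

/-! ### Entropies along a run -/

/-- For the erasure pattern `s`, the entropy of the symbol sent in slot `t` given the messages of
the receivers in `T` and what the receivers in `T'` have received before. -/
noncomputable def inputEntropy (c : PECFeedbackCode K F n m) (s : Fin n → Finset (Fin K))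
    (T T' : Finset (Fin K)) (t : Fin n) : ℝ :=
  uniformCondEntropy (fun x => c.input x s t) (fun x => (messagePart T x, c.view s T' t x))

lemma inputEntropy_update (c : PECFeedbackCode K F n m) (s : Fin n → Finset (Fin K))
    (T T' : Finset (Fin K)) (t : Fin n) (S : Finset (Fin K)) :
    c.inputEntropy (Function.update s t S) T T' t = c.inputEntropy s T T' t := by
  have hs : ∀ τ < t, Function.update s t S τ = s τ := fun τ hτ => Function.update_of_ne hτ.ne _ _
  have h1 : ∀ τ ≤ t, ∀ x : PECMessages F m,
      c.input x (Function.update s t S) τ = c.input x s τ :=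
    fun τ hτ x => c.input_congr x τ fun σ hσ => hs σ (hσ.trans_le hτ)
  rw [inputEntropy, inputEntropy]
  congr 1
  · funext x
    exact h1 t le_rfl x
  · funext x
    congr 1
    funext τ
    by_cases hτ : τ < t
    · simp only [view, hs τ hτ, h1 τ hτ.le]
    · have hτ' : ¬ τ.val < t.val := hτ
      simp only [view, hτ', false_and, if_false]

lemma inputEntropy_nonneg (c : PECFeedbackCode K F n m) (s : Fin n → Finset (Fin K))
    (T T' : Finset (Fin K)) (t : Fin n) : 0 ≤ c.inputEntropy s T T' t :=
  uniformCondEntropy_nonneg _ _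

lemma inputEntropy_anti (c : PECFeedbackCode K F n m) (s : Fin n → Finset (Fin K))
    {T₁ T₂ T₁' T₂' : Finset (Fin K)} (h : T₁ ⊆ T₂) (h' : T₁' ⊆ T₂') (t : Fin n) :
    c.inputEntropy s T₂ T₂' t ≤ c.inputEntropy s T₁ T₁' t := by
  refine uniformCondEntropy_anti _ fun x x' hx => ?_
  simp only [Prod.mk.injEq, messagePart_eq_iff, view_eq_iff] at hx ⊢
  exact ⟨fun k hk => hx.1 k (h hk), fun τ hτ hne =>
    hx.2 τ hτ (hne.mono (Finset.inter_subset_inter_left h'))⟩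

/-- Chain rule: a slot contributes the entropy of its input if the symbol reaches `T'`, and
nothing otherwise. -/
lemma uniformEntropy_view_sub (c : PECFeedbackCode K F n m) (s : Fin n → Finset (Fin K))
    (T T' : Finset (Fin K)) :
    uniformEntropy (fun x : PECMessages F m => (messagePart T x, c.view s T' n x)) -
        uniformEntropy (fun x : PECMessages F m => messagePart T x) =
      ∑ t, if (s t ∩ T').Nonempty then c.inputEntropy s T T' t else 0 := by
  set e : ℕ → ℝ := fun i =>
    uniformEntropy (fun x : PECMessages F m => (messagePart T x, c.view s T' i x)) with he
  have h0 : uniformEntropy (fun x : PECMessages F m => messagePart T x) = e 0 :=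
    uniformEntropy_congr fun x x' => by
      simp only [Prod.mk.injEq, view_eq_iff]
      simp
  rw [h0]
  change e n - e 0 = _
  rw [← Finset.sum_range_sub, Finset.sum_range]
  refine Finset.sum_congr rfl fun t _ => ?_
  split_ifs with h
  · rw [inputEntropy, uniformCondEntropy]
    congr 1
    refine uniformEntropy_congr fun x x' => ?_
    simp only [Prod.mk.injEq, view_eq_iff]
    constructor
    · rintro ⟨hm, hv⟩
      exact ⟨hv t (Nat.lt_succ_self _) h, hm, fun τ hτ => hv τ (by omega)⟩
    · rintro ⟨hi, hm, hv⟩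
      refine ⟨hm, fun τ hτ hne => ?_⟩
      rcases Nat.lt_succ_iff_lt_or_eq.1 hτ with h1 | h1
      · exact hv τ h1 hne
      · rwa [Fin.ext h1]
  · rw [sub_eq_zero]
    refine uniformEntropy_congr fun x x' => ?_
    simp only [Prod.mk.injEq, view_eq_iff]
    refine and_congr_right fun _ => forall_congr' fun τ => ?_
    constructor
    · exact fun hv hτ => hv (by omega)
    · intro hv hτ hne
      rcases Nat.lt_succ_iff_lt_or_eq.1 hτ with h1 | h1
      · exact hv h1 hne
      · exact absurd (Fin.ext h1 ▸ hne) h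

lemma fiberCard_messagePart (T : Finset (Fin K)) (x : PECMessages F m) :
    fiberCard (fun x : PECMessages F m => messagePart T x) x =
      ∏ k, if k ∈ T then 1 else Fintype.card (Fin (m k) → F) := by
  classical
  have : fiberCard (fun x : PECMessages F m => messagePart T x) x =
      #(Fintype.piFinset fun k => if k ∈ T then {x k} else univ) := by
    rw [fiberCard]
    congr 1
    ext x'
    simp only [mem_filter, mem_univ, true_and, messagePart_eq_iff, Fintype.mem_piFinset]
    refine forall_congr' fun k => ?_
    by_cases h : k ∈ T <;> simp [h]
  rw [this]
  rw [Fintype.card_piFinset]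
  refine Finset.prod_congr rfl fun k _ => ?_
  by_cases h : k ∈ T
  · simp [h]
  · simp only [h, if_false, Finset.card_univ]

variable [Nonempty F]

lemma inputEntropy_le_log_card (c : PECFeedbackCode K F n m) (s : Fin n → Finset (Fin K))
    (T T' : Finset (Fin K)) (t : Fin n) :
    c.inputEntropy s T T' t ≤ Real.log (Fintype.card F) :=
  uniformCondEntropy_le_log_card _ _

lemma uniformEntropy_messagePart_insert_sub {T : Finset (Fin K)} {k : Fin K} (hk : k ∉ T) :
    uniformEntropy (fun x : PECMessages F m => messagePart (insert k T) x) -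
        uniformEntropy (fun x : PECMessages F m => messagePart T x) =
      Real.log (Fintype.card (Fin (m k) → F)) := by
  classical
  have hX : (Fintype.card (PECMessages F m) : ℝ) ≠ 0 := by exact_mod_cast Fintype.card_ne_zero
  have hfib : ∀ x : PECMessages F m, fiberCard (fun x : PECMessages F m => messagePart T x) x =
      Fintype.card (Fin (m k) → F) *
        fiberCard (fun x : PECMessages F m => messagePart (insert k T) x) x := by
    intro x
    rw [fiberCard_messagePart, fiberCard_messagePart, ← Finset.mul_prod_erase univ _ (mem_univ k),
      ← Finset.mul_prod_erase univ
        (fun l => if l ∈ insert k T then 1 else Fintype.card (Fin (m l) → F)) (mem_univ k)]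
    simp only [hk, if_false, mem_insert_self, if_true, one_mul]
    congr 1
    refine Finset.prod_congr rfl fun l hl => ?_
    simp only [mem_insert, Finset.ne_of_mem_erase hl, false_or]
  rw [uniformEntropy, uniformEntropy, ← sub_div, ← Finset.sum_sub_distrib, div_eq_iff hX,
    mul_comm, ← nsmul_eq_mul, ← Finset.card_univ, ← Finset.sum_const]
  refine Finset.sum_congr rfl fun x _ => ?_
  have h1 : (fiberCard (fun x : PECMessages F m => messagePart (insert k T) x) x : ℝ) ≠ 0 := by
    exact_mod_cast (fiberCard_pos _ x).ne'
  have h2 : (Fintype.card (Fin (m k) → F) : ℝ) ≠ 0 := by exact_mod_cast Fintype.card_ne_zero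
  rw [hfib x, Finset.card_univ, Nat.cast_mul, Real.log_div hX h1, Real.log_div hX (mul_ne_zero h2 h1),
    Real.log_mul h2 h1]
  ring

/-- Fano's inequality for the decoder of receiver `k`: its observations are a function of the view
of any group of receivers that contains `k`. -/
lemma uniformEntropy_decode_le (c : PECFeedbackCode K F n m) (s : Fin n → Finset (Fin K))
    (T : Finset (Fin K)) (k : Fin K) :
    uniformEntropy (fun x : PECMessages F m =>
          (messagePart (insert k T) x, c.view s (insert k T) n x)) -
        uniformEntropy (fun x : PECMessages F m =>
          (messagePart T x, c.view s (insert k T) n x)) ≤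
      Real.log 2 + c.patternError s k * Real.log (Fintype.card (Fin (m k) → F)) := by
  classical
  have h := uniformCondEntropy_le_fano (fun x : PECMessages F m => x k)
    (fun x : PECMessages F m => (messagePart T x, c.view s (insert k T) n x))
    (fun v => c.decode k fun t => if k ∈ s t then v.2 t else none)
  have hout : ∀ x : PECMessages F m,
      (fun t => if k ∈ s t then c.view s (insert k T) n x t else none) =
        fun t => c.outputs x s t k := by
    intro x
    funext t
    rw [outputs_eq, received]
    by_cases hk : k ∈ s t
    · simp [hk, view]
    · simp [hk]
  simp only [hout] at h
  refine le_trans (le_of_eq ?_) (h.trans (le_of_eq ?_))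
  · rw [uniformCondEntropy]
    congr 1
    refine uniformEntropy_congr fun x x' => ?_
    simp only [Prod.mk.injEq, messagePart_eq_iff, mem_insert, forall_eq_or_imp, and_assoc]
  · simp only [patternError]

/-- For each erasure pattern, the information that receiver `k` must extract from the slots that
reach `insert k T`. -/
lemma log_card_mul_le_sum_inputEntropy (c : PECFeedbackCode K F n m)
    (s : Fin n → Finset (Fin K)) {T : Finset (Fin K)} {k : Fin K} (hk : k ∉ T) :
    Real.log (Fintype.card (Fin (m k) → F)) * (1 - c.patternError s k) - Real.log 2 ≤
      ∑ t, (if (s t ∩ insert k T).Nonempty then 1 else 0) *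
        (c.inputEntropy s T (insert k T) t - c.inputEntropy s (insert k T) (insert k T) t) := by
  have h1 := c.uniformEntropy_view_sub s T (insert k T)
  have h2 := c.uniformEntropy_view_sub s (insert k T) (insert k T)
  have h3 := uniformEntropy_messagePart_insert_sub (F := F) (m := m) hk
  have h4 := c.uniformEntropy_decode_le s T k
  simp only [mul_sub, ite_mul, one_mul, zero_mul, Finset.sum_sub_distrib]
  rw [← h1, ← h2]
  linarith

end PECFeedbackCode

/-! ### The outer bound for one code -/

namespace PECFeedbackCode

open BroadcastPEC

variable {K : ℕ} {F : Type} [Fintype F] {n : ℕ} {m : Fin K → ℕ}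

/-- The input entropies given messages and past receptions, averaged over the erasure pattern and
summed over the slots. -/
noncomputable def meanInputEntropy (c : PECFeedbackCode K F n m) (C : BroadcastPEC K)
    (T T' : Finset (Fin K)) : ℝ :=
  ∑ t, ∑ s, C.patternProb s * c.inputEntropy s T T' t

lemma meanInputEntropy_nonneg (c : PECFeedbackCode K F n m) (C : BroadcastPEC K)
    (T T' : Finset (Fin K)) : 0 ≤ c.meanInputEntropy C T T' :=
  Finset.sum_nonneg fun t _ => Finset.sum_nonneg fun s _ =>
    mul_nonneg (C.patternProb_nonneg s) (c.inputEntropy_nonneg s T T' t)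

lemma meanInputEntropy_anti (c : PECFeedbackCode K F n m) (C : BroadcastPEC K)
    {T₁ T₂ T₁' T₂' : Finset (Fin K)} (h : T₁ ⊆ T₂) (h' : T₁' ⊆ T₂') :
    c.meanInputEntropy C T₂ T₂' ≤ c.meanInputEntropy C T₁ T₁' :=
  Finset.sum_le_sum fun t _ => Finset.sum_le_sum fun s _ =>
    mul_le_mul_of_nonneg_left (c.inputEntropy_anti s h h' t) (C.patternProb_nonneg s)

variable [Nonempty F]

lemma meanInputEntropy_le (c : PECFeedbackCode K F n m) (C : BroadcastPEC K)
    (T T' : Finset (Fin K)) : c.meanInputEntropy C T T' ≤ n * Real.log (Fintype.card F) := by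
  calc c.meanInputEntropy C T T'
      ≤ ∑ _t : Fin n, ∑ s, C.patternProb s * Real.log (Fintype.card F) :=
        Finset.sum_le_sum fun t _ => Finset.sum_le_sum fun s _ =>
          mul_le_mul_of_nonneg_left (c.inputEntropy_le_log_card s T T' t) (C.patternProb_nonneg s)
    _ = n * Real.log (Fintype.card F) := by
        simp [← Finset.sum_mul, C.sum_patternProb]

/-- Averaged over the erasure pattern, a slot reaches `insert k T` with probability
`C.pUnion (insert k T)`, independently of the entropy of its input; and the smaller group `T` has
seen less of the past, whence its larger entropy on the right. -/
lemma message_entropy_le (c : PECFeedbackCode K F n m) (C : BroadcastPEC K)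
    {T : Finset (Fin K)} {k : Fin K} (hk : k ∉ T) :
    m k * Real.log (Fintype.card F) * (1 - c.errorProb C k) - Real.log 2 ≤
      C.pUnion (insert k T) *
        (c.meanInputEntropy C T T - c.meanInputEntropy C (insert k T) (insert k T)) := by
  classical
  set T' := insert k T with hT'
  have hlog : Real.log (Fintype.card (Fin (m k) → F)) = m k * Real.log (Fintype.card F) := by
    rw [Fintype.card_fun, Fintype.card_fin, Nat.cast_pow, Real.log_pow]
  have hlog0 : 0 ≤ m k * Real.log (Fintype.card F) :=
    mul_nonneg (Nat.cast_nonneg _) (Real.log_natCast_nonneg _)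
  calc m k * Real.log (Fintype.card F) * (1 - c.errorProb C k) - Real.log 2
      ≤ m k * Real.log (Fintype.card F) * (1 - ∑ s, C.patternProb s * c.patternError s k)
          - Real.log 2 := by
        gcongr
        exact c.sum_patternProb_mul_patternError_le C k
    _ = ∑ s, C.patternProb s *
          (m k * Real.log (Fintype.card F) * (1 - c.patternError s k) - Real.log 2) := by
        have h : ∀ s, C.patternProb s *
            (m k * Real.log (Fintype.card F) * (1 - c.patternError s k) - Real.log 2) =
            C.patternProb s * (m k * Real.log (Fintype.card F) - Real.log 2) -
            (m k * Real.log (Fintype.card F)) * (C.patternProb s * c.patternError s k) :=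
          fun s => by ring
        simp only [h]
        rw [Finset.sum_sub_distrib, ← Finset.sum_mul, ← Finset.mul_sum, C.sum_patternProb]
        ring
    _ ≤ ∑ s, C.patternProb s * ∑ t, (if (s t ∩ T').Nonempty then 1 else 0) *
          (c.inputEntropy s T T' t - c.inputEntropy s T' T' t) := by
        refine Finset.sum_le_sum fun s _ =>
          mul_le_mul_of_nonneg_left ?_ (C.patternProb_nonneg s)
        rw [← hlog]
        exact c.log_card_mul_le_sum_inputEntropy s hk
    _ = ∑ t, ∑ s, C.patternProb s * ((if (s t ∩ T').Nonempty then 1 else 0) *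
          (c.inputEntropy s T T' t - c.inputEntropy s T' T' t)) := by
        simp only [Finset.mul_sum]
        exact Finset.sum_comm
    _ = ∑ t, C.pUnion T' * ∑ s, C.patternProb s *
          (c.inputEntropy s T T' t - c.inputEntropy s T' T' t) := by
        refine Finset.sum_congr rfl fun t _ => ?_
        rw [C.sum_patternProb_mul t (fun S => if (S ∩ T').Nonempty then 1 else 0)
          (fun s => c.inputEntropy s T T' t - c.inputEntropy s T' T' t)
          (fun s S => by rw [inputEntropy_update, inputEntropy_update])]
        congr 1
        rw [pUnion, Finset.sum_filter]
        simp only [mul_ite, mul_one, mul_zero]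
    _ = C.pUnion T' * (c.meanInputEntropy C T T' - c.meanInputEntropy C T' T') := by
        rw [← Finset.mul_sum, meanInputEntropy, meanInputEntropy, ← Finset.sum_sub_distrib]
        simp only [mul_sub, Finset.sum_sub_distrib]
    _ ≤ _ := by
        refine mul_le_mul_of_nonneg_left ?_ (C.pUnion_nonneg _)
        exact sub_le_sub_right
          (c.meanInputEntropy_anti C subset_rfl (Finset.subset_insert k T)) _

end PECFeedbackCode

/-- The first `i` receivers under `π`. -/
def initialReceivers {K : ℕ} (π : Equiv.Perm (Fin K)) (i : ℕ) : Finset (Fin K) :=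
  ({j | j.val < i} : Finset (Fin K)).image π

lemma apply_notMem_initialReceivers {K : ℕ} (π : Equiv.Perm (Fin K)) (j : Fin K) :
    π j ∉ initialReceivers π j := by
  simp [initialReceivers]

lemma insert_initialReceivers {K : ℕ} (π : Equiv.Perm (Fin K)) (j : Fin K) :
    insert (π j) (initialReceivers π j) = initialReceivers π (j + 1) := by
  rw [initialReceivers, initialReceivers, ← Finset.image_insert]
  congr 1
  ext l
  simp only [mem_insert, mem_filter, mem_univ, true_and, Fin.ext_iff]
  omega

lemma firstReceivers_eq_initialReceivers {K : ℕ} (π : Equiv.Perm (Fin K)) (j : Fin K) :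
    firstReceivers π j = initialReceivers π (j + 1) := by
  rw [firstReceivers, initialReceivers]
  congr 1
  ext l
  simp only [mem_Iic, mem_filter, mem_univ, true_and, Fin.le_def]
  omega

namespace PECFeedbackCode

open BroadcastPEC

variable {K : ℕ} {F : Type} [Fintype F] [Nontrivial F] {n : ℕ} {m : Fin K → ℕ}

/-- The telescoped bound: the `n` slots are shared among the receivers, `Δ j` being the drop of
`meanInputEntropy` when `π j` joins the group, in units of `log |F|`. In these units the entropy
`log 2` lost in Fano's inequality is at most `1`. -/
lemma exists_budget (c : PECFeedbackCode K F n m) (C : BroadcastPEC K)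
    (π : Equiv.Perm (Fin K)) :
    ∃ Δ : Fin K → ℝ, (∀ j, 0 ≤ Δ j) ∧ ∑ j, Δ j ≤ n ∧
      ∀ j, m (π j) * (1 - c.errorProb C (π j)) - 1 ≤ C.pUnion (firstReceivers π j) * Δ j := by
  have hq : (2 : ℝ) ≤ Fintype.card F := by exact_mod_cast Fintype.one_lt_card (α := F)
  have hL : 0 < Real.log (Fintype.card F) := Real.log_pos (by linarith)
  have hL2 : Real.log 2 ≤ Real.log (Fintype.card F) := Real.log_le_log (by norm_num) hq
  set e : ℕ → ℝ := fun i =>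
    c.meanInputEntropy C (initialReceivers π i) (initialReceivers π i) with he
  refine ⟨fun j => (e j - e (j + 1)) / Real.log (Fintype.card F), fun j => ?_, ?_, fun j => ?_⟩
  · refine div_nonneg (sub_nonneg.2 ?_) hL.le
    have h : initialReceivers π j ⊆ initialReceivers π (j + 1) := by
      rw [← insert_initialReceivers]
      exact Finset.subset_insert _ _
    exact c.meanInputEntropy_anti C h h
  · rw [← Finset.sum_div, div_le_iff₀ hL, ← Finset.sum_range (fun i => e i - e (i + 1)),
      Finset.sum_range_sub']
    have h1 := c.meanInputEntropy_le C (initialReceivers π 0) (initialReceivers π 0)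
    have h2 := c.meanInputEntropy_nonneg C (initialReceivers π K) (initialReceivers π K)
    simp only [he]
    linarith
  · have h := c.message_entropy_le C (apply_notMem_initialReceivers π j)
    rw [insert_initialReceivers] at h
    rw [firstReceivers_eq_initialReceivers, ← mul_div_assoc, le_div_iff₀ hL]
    simp only [he]
    linarith

end PECFeedbackCode

/-! ### Letting the block length grow -/

/-- The two units lost are one from Fano's inequality and one from rounding the message lengths. -/
lemma BroadcastPEC.Achievable.exists_budget {K : ℕ} {C : BroadcastPEC K} {R : Fin K → ℝ}
    (hR : C.Achievable R) (π : Equiv.Perm (Fin K)) {ε : ℝ} (hε : 0 < ε) (hε1 : ε ≤ 1) (N : ℕ) :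
    ∃ n : ℕ, N ≤ n ∧ ∃ Δ : Fin K → ℝ, (∀ j, 0 ≤ Δ j) ∧ ∑ j, Δ j ≤ n ∧
      ∀ j, n * ((1 - ε) * R (π j)) - 2 ≤ C.pUnion (firstReceivers π j) * Δ j := by
  obtain ⟨n, hn, F, _, _, c, hc⟩ := hR.2 ε hε N
  obtain ⟨Δ, h0, h1, h2⟩ := c.exists_budget C π
  refine ⟨n, hn, Δ, h0, h1, fun j => le_trans ?_ (h2 j)⟩
  set M : ℕ := ⌊(n : ℝ) * R (π j)⌋₊ with hM
  have hfloor : (n : ℝ) * R (π j) < M + 1 := Nat.lt_floor_add_one _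
  have hM0 : (0 : ℝ) ≤ M := Nat.cast_nonneg _
  have h3 : (M : ℝ) * (1 - ε) ≤ M * (1 - c.errorProb C (π j)) :=
    mul_le_mul_of_nonneg_left (by linarith [hc (π j)]) hM0
  have h4 : (n : ℝ) * R (π j) * (1 - ε) ≤ (M + 1) * (1 - ε) :=
    mul_le_mul_of_nonneg_right hfloor.le (by linarith)
  linarith

lemma le_of_forall_exists_nat_mul_le {a b B : ℝ}
    (h : ∀ N : ℕ, ∃ n : ℕ, N ≤ n ∧ n * a ≤ n * b + B) : a ≤ b := by
  by_contra! hab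
  obtain ⟨N, hN⟩ := exists_nat_gt (B / (a - b))
  obtain ⟨n, hn, hle⟩ := h N
  have hNn : (N : ℝ) ≤ n := Nat.cast_le.2 hn
  have := (div_lt_iff₀ (sub_pos.2 hab)).1 (hN.trans_le hNn)
  linarith

lemma le_of_forall_one_sub_mul_le {a b : ℝ}
    (h : ∀ ε : ℝ, 0 < ε → ε ≤ 1 → (1 - ε) * a ≤ b) : a ≤ b := by
  have h1 : Filter.Tendsto (fun ε : ℝ => (1 - ε) * a) (nhdsWithin 0 (Set.Ioi 0)) (nhds a) := by
    have : ContinuousAt (fun ε : ℝ => (1 - ε) * a) 0 := by fun_prop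
    simpa using this.tendsto.mono_left nhdsWithin_le_nhds
  refine le_of_tendsto h1 ?_
  filter_upwards [Ioc_mem_nhdsGT (zero_lt_one' ℝ)] with ε hε
  exact h ε hε.1 hε.2

theorem mainTheorem2 {K : ℕ} (C : BroadcastPEC K) (R : Fin K → ℝ) (hR : C.Achievable R)
    (π : Equiv.Perm (Fin K)) :
    (∀ j, C.pUnion (firstReceivers π j) = 0 → R (π j) = 0) ∧
      ∑ j, R (π j) / C.pUnion (firstReceivers π j) ≤ 1 := by
  constructor
  · intro j hj
    refine le_antisymm (le_of_forall_one_sub_mul_le fun ε hε hε1 => ?_) (hR.1 _)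
    refine le_of_forall_exists_nat_mul_le (B := 2) fun N => ?_
    obtain ⟨n, hn, Δ, -, -, h⟩ := hR.exists_budget π hε hε1 N
    have := h j
    rw [hj] at this
    exact ⟨n, hn, by linarith⟩
  · refine le_of_forall_one_sub_mul_le fun ε hε hε1 => ?_
    refine le_of_forall_exists_nat_mul_le
      (B := ∑ j, 2 / C.pUnion (firstReceivers π j)) fun N => ?_
    obtain ⟨n, hn, Δ, h0, h1, h⟩ := hR.exists_budget π hε hε1 N
    refine ⟨n, hn, ?_⟩
    -- A vanishing denominator is harmless: the quotient is then `0 ≤ Δ j`.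
    have hdiv : ∀ j, (n * ((1 - ε) * R (π j)) - 2) / C.pUnion (firstReceivers π j) ≤ Δ j :=
      fun j => div_le_of_le_mul₀ (C.pUnion_nonneg _) (h0 j) (by linarith [h j])
    have hsum := (Finset.sum_le_sum fun j _ => hdiv j).trans h1
    simp only [sub_div, Finset.sum_sub_distrib] at hsum
    rw [Finset.mul_sum, Finset.mul_sum, mul_one]
    simp only [← mul_div_assoc]
    linarith
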